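/- All graphs are finite and simple. For graphs $G$ and $H$, the planar Ramsey number $PR(G,H)$ is the smallest integer $N$ such that every planar graph $F$ on $N$ vertices contains a copy of $G$ as a (not necessarily induced) subgraph, or the complement of $F$ contains a copy of $H$ as a (not necessarily induced) subgraph. Let $C_k$ be the cycle of length $k$, and let the wheel $W_n=\{x\}+C_n$ be the graph on $n+1$ vertices obtained from $C_n$ by adding a new vertex $x$ adjacent to every vertex of $C_n$. Then \[ PR(C_4,W_n)\ \ge\ \begin{cases} n+4, & \text{if } 7\le n\le 25 \text{ or } n\in\{27,28,29,30,31,33,34,36,37,39\};\\[2pt] n+5, & \text{if } n\in\{26,32,35,38\} \text{ or } n\ge 40.\end{cases} \] -/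

import Mathlib

/-- A drawing of the graph `G` in the Euclidean plane without crossings: distinct vertices are
distinct points, every edge is a simple arc joining its two end vertices, no arc passes through
a vertex in its interior, and arcs of different edges do not meet in their interiors. -/
structure PlaneDrawing {V : Type*} (G : SimpleGraph V) where
  point : V → EuclideanSpace ℝ (Fin 2)
  arc : G.edgeSet → C(unitInterval, EuclideanSpace ℝ (Fin 2))
  point_injective : Function.Injective point
  arc_injective : ∀ e, Function.Injective (arc e)
  arc_endpoints : ∀ e, s(arc e 0, arc e 1) = Sym2.map point (e : Sym2 V)
  arc_avoids_points : ∀ e, ∀ t : unitInterval, 0 < t → t < 1 → ∀ v, arc e t ≠ point v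
  arcs_disjoint : ∀ e f, e ≠ f → ∀ s t : unitInterval, 0 < s → s < 1 → 0 < t → t < 1 →
    arc e s ≠ arc f t

/-- A graph is planar if it can be drawn in the plane without crossings. -/
def IsPlanarGraph {V : Type*} (G : SimpleGraph V) : Prop :=
  Nonempty (PlaneDrawing G)

/-- The graph `{x} + G`: the graph `G` together with one new vertex `none`, the hub, which is
adjacent to every vertex of `G`. -/
def coneGraph {V : Type*} (G : SimpleGraph V) : SimpleGraph (Option V) where
  Adj
    | none, none => False
    | none, some _ => True
    | some _, none => True
    | some u, some v => G.Adj u v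
  symm := ⟨by
    rintro (_ | u) (_ | v) h
    · exact h
    · trivial
    · trivial
    · exact SimpleGraph.Adj.symm h⟩
  loopless := ⟨by
    rintro (_ | u) h
    · exact h
    · exact G.irrefl h⟩

/-- The wheel `W_n = {x} + C_n` with `n` spokes; it has `n + 1` vertices. -/
def wheelGraph (n : ℕ) : SimpleGraph (Option (Fin n)) :=
  coneGraph (SimpleGraph.cycleGraph n)

/-- The planar Ramsey number `PR(G, H)`: the smallest `N` such that every planar graph on `N`
vertices contains a copy of `G` (as a not necessarily induced subgraph) or its complement
contains a copy of `H`. -/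
noncomputable def planarRamsey {V W : Type*} (G : SimpleGraph V) (H : SimpleGraph W) : ℕ :=
  sInf {N : ℕ | ∀ F : SimpleGraph (Fin N), IsPlanarGraph F → G.IsContained F ∨ H.IsContained Fᶜ}

/-!
Let `F` be a planar graph without 4-cycles, of order `n + d` and minimum degree at least `d`. In the
complement of `F` every vertex has at most `n - 1` neighbours, so it can be neither the hub of a
wheel with `n` spokes nor the apex of the cone over any other graph of order `n`. Hence
`PR(C₄, W_n) > n + d`.

It remains to find such graphs with `d = 3` and `d = 4`. Their orders are closed under addition, by
disjoint union, so finitely many examples suffice. These are straight-line drawings with vertices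
in a small integer grid, so that planarity becomes a finite computation with orientations of triples
of grid points.
-/

open SimpleGraph

section Ramsey

variable {V W α β : Type*}

theorem exists_isNClique_or_compl_isNClique (G : SimpleGraph V) (s t : ℕ) (A : Finset V)
    (hA : (s + t).choose s ≤ A.card) :
    (∃ S ⊆ A, G.IsNClique s S) ∨ ∃ S ⊆ A, Gᶜ.IsNClique t S := by
  classical
  induction s generalizing t A with
  | zero => exact .inl ⟨∅, A.empty_subset, by simp [isNClique_iff]⟩
  | succ s ihs =>
    induction t generalizing A with
    | zero => exact .inr ⟨∅, A.empty_subset, by simp [isNClique_iff]⟩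
    | succ t iht =>
      obtain ⟨v, hv⟩ : A.Nonempty :=
        Finset.card_pos.mp <| (Nat.choose_pos (Nat.le_add_right _ _)).trans_le hA
      have hsplit := Finset.card_filter_add_card_filter_not (s := A.erase v) (G.Adj v)
      rw [Finset.card_erase_of_mem hv] at hsplit
      have hpascal : (s + 1 + (t + 1)).choose (s + 1)
          = (s + (t + 1)).choose s + (s + 1 + t).choose (s + 1) := by
        rw [show s + 1 + (t + 1) = s + (t + 1) + 1 by ring, Nat.choose_succ_succ,
          show s + (t + 1) = s + 1 + t by ring]
      have hsub : ∀ (P : V → Prop) [DecidablePred P], (A.erase v).filter P ⊆ A := fun P _ =>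
        (Finset.filter_subset P _).trans (A.erase_subset v)
      by_cases hnbrs : (s + (t + 1)).choose s ≤ ((A.erase v).filter (G.Adj v)).card
      · obtain ⟨S, hS, hclique⟩ | ⟨S, hS, hclique⟩ := ihs (t + 1) _ hnbrs
        · exact .inl ⟨insert v S, Finset.insert_subset hv (hS.trans (hsub _)),
            hclique.insert fun w hw => (Finset.mem_filter.mp (hS hw)).2⟩
        · exact .inr ⟨S, hS.trans (hsub _), hclique⟩
      · obtain ⟨S, hS, hclique⟩ | ⟨S, hS, hclique⟩ :=
          iht ((A.erase v).filter fun w => ¬G.Adj v w) (by omega)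
        · exact .inl ⟨S, hS.trans (hsub _), hclique⟩
        · refine .inr ⟨insert v S, Finset.insert_subset hv (hS.trans (hsub _)),
            hclique.insert fun w hw => ?_⟩
          obtain ⟨hwA, hvw⟩ := Finset.mem_filter.mp (hS hw)
          exact (compl_adj _ _ _).mpr ⟨(Finset.ne_of_mem_erase hwA).symm, hvw⟩

theorem isContained_of_isNClique_card [Fintype W] {G : SimpleGraph V} (H : SimpleGraph W)
    {S : Finset V} (hS : G.IsNClique (Fintype.card W) S) : H ⊑ G := by
  have hcomplete : (⊤ : SimpleGraph (Fin (Fintype.card W))) ⊑ G :=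
    (not_cliqueFree_iff_top_isContained _).mp fun hfree => hfree S hS
  exact (IsContained.of_le le_top).trans <|
    (Iso.completeGraph (Fintype.equivFin W)).isContained.trans hcomplete

theorem exists_forall_isContained_or_isContained_compl [Finite α] [Finite β]
    (A : SimpleGraph α) (B : SimpleGraph β) :
    ∃ N : ℕ, ∀ F : SimpleGraph (Fin N), A ⊑ F ∨ B ⊑ Fᶜ := by
  have := Fintype.ofFinite α
  have := Fintype.ofFinite β
  refine ⟨(Fintype.card α + Fintype.card β).choose (Fintype.card α), fun F => ?_⟩
  exact (exists_isNClique_or_compl_isNClique F _ _ Finset.univ (by simp)).imp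
    (fun ⟨_, _, h⟩ => isContained_of_isNClique_card A h)
    (fun ⟨_, _, h⟩ => isContained_of_isNClique_card B h)

theorem IsPlanarGraph.comap {G : SimpleGraph V} (hG : IsPlanarGraph G) {f : W → V}
    (hf : f.Injective) : IsPlanarGraph (G.comap f) := by
  obtain ⟨D⟩ := hG
  let edge : (G.comap f).edgeSet → G.edgeSet := (Embedding.comap ⟨f, hf⟩ G).mapEdgeSet
  have hedge : edge.Injective := (Embedding.comap ⟨f, hf⟩ G).mapEdgeSet.injective
  exact ⟨{
    point := D.point ∘ f
    arc := D.arc ∘ edge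
    point_injective := D.point_injective.comp hf
    arc_injective := fun e => D.arc_injective (edge e)
    arc_endpoints := fun e => (D.arc_endpoints (edge e)).trans (Sym2.map_map ..)
    arc_avoids_points := fun e t h0 h1 w => D.arc_avoids_points (edge e) t h0 h1 (f w)
    arcs_disjoint := fun e e' hne => D.arcs_disjoint (edge e) (edge e') (hedge.ne hne) }⟩

theorem card_lt_planarRamsey [Finite α] [Finite β] {A : SimpleGraph α} {B : SimpleGraph β}
    [Fintype V] {G : SimpleGraph V} (hplanar : IsPlanarGraph G) (hA : A.Free G)
    (hB : B.Free Gᶜ) : Fintype.card V < planarRamsey A B := by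
  by_contra! hle
  obtain ⟨N, hN⟩ := exists_forall_isContained_or_isContained_compl A B
  have hmem : planarRamsey A B ∈ {N : ℕ | ∀ F : SimpleGraph (Fin N), IsPlanarGraph F →
      A.IsContained F ∨ B.IsContained Fᶜ} := Nat.sInf_mem ⟨N, fun F _ => hN F⟩
  let f : Fin (planarRamsey A B) ↪ V :=
    (Fin.castLEEmb hle).trans (Fintype.equivFin V).symm.toEmbedding
  obtain hA' | hB' := hmem (G.comap f) (hplanar.comap f.injective)
  · exact hA (hA'.trans (Embedding.comap f G).isContained)
  · exact hB (hB'.trans (Embedding.complEquiv (Embedding.comap f G)).isContained)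

end Ramsey

section Free

variable {V W : Type*} {G : SimpleGraph V}

theorem cycleGraph_four_free_of_commonNeighbors_subsingleton
    (h : ∀ a b, a ≠ b → (G.commonNeighbors a b).Subsingleton) : (cycleGraph 4).Free G := by
  rintro ⟨f⟩
  have hadj (i j : Fin 4) (hij : (cycleGraph 4).Adj i j) : G.Adj (f i) (f j) :=
    f.toHom.map_adj hij
  have heq : f 1 = f 3 := h (f 0) (f 2) (f.injective.ne (by decide))
    ⟨hadj 0 1 (by decide), hadj 2 1 (by decide)⟩ ⟨hadj 0 3 (by decide), hadj 2 3 (by decide)⟩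
  exact absurd (f.injective heq) (by decide)

theorem coneGraph_free_compl [Fintype V] [Fintype W] (H : SimpleGraph W) {d : ℕ}
    (hcard : Fintype.card V ≤ Fintype.card W + d) (hdeg : ∀ v, d ≤ (G.neighborSet v).ncard) :
    (coneGraph H).Free Gᶜ := by
  rintro ⟨f⟩
  have hdisj : Disjoint (G.neighborSet (f none)) (Set.range f) := by
    rw [Set.disjoint_right]
    rintro _ ⟨w | w, rfl⟩ hadj
    · exact G.irrefl hadj
    · have hspoke : Gᶜ.Adj (f none) (f (some w)) :=
        f.toHom.map_adj (show (coneGraph H).Adj none (some w) from trivial)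
      exact hspoke.2 hadj
  have hinj : Function.Injective f := f.injective
  have hrange : (Set.range f).ncard = Fintype.card W + 1 := by
    rw [Set.ncard_range_of_injective hinj, Nat.card_eq_fintype_card, Fintype.card_option]
  have hunion := Set.ncard_le_card (G.neighborSet (f none) ∪ Set.range f)
  rw [Set.ncard_union_eq hdisj, hrange, Nat.card_eq_fintype_card] at hunion
  linarith [hdeg (f none)]

end Free

section StraightDrawing

variable {V W E : Type*} [AddCommGroup E] [Module ℝ E]

theorem disjoint_segment_segment_of_lt {x y u v : E} (φ : E →ₗ[ℝ] ℝ) {c : ℝ} (hx : φ x < c)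
    (hy : φ y < c) (hu : c < φ u) (hv : c < φ v) : Disjoint (segment ℝ x y) (segment ℝ u v) :=
  Set.disjoint_of_subset ((convex_halfSpace_lt φ.isLinear c).segment_subset hx hy)
    ((convex_halfSpace_gt φ.isLinear c).segment_subset hu hv) <|
    Set.disjoint_left.mpr fun _ hlt hgt => lt_asymm (Set.mem_ofPred.mp hlt) hgt

theorem segment_inter_segment_subset_of_le {x y u v : E} (φ : E →ₗ[ℝ] ℝ) (hxy : φ x = φ y)
    (hu : u ∈ ({x, y} : Set E) ∨ φ x < φ u) (hv : v ∈ ({x, y} : Set E) ∨ φ x < φ v) (huv : u ≠ v)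
    (hne : s(x, y) ≠ s(u, v)) : segment ℝ x y ∩ segment ℝ u v ⊆ {x, y} ∩ {u, v} := by
  rintro z ⟨hz, a, b, ha, hb, hab, rfl⟩
  have hline : segment ℝ x y ⊆ {w | φ w = φ x} :=
    (convex_hyperplane φ.isLinear (φ x)).segment_subset rfl hxy.symm
  have hcomb : a * φ u + b * φ v = φ x := by simpa using hline hz
  have hle (w : E) : w ∈ ({x, y} : Set E) ∨ φ x < φ w → 0 ≤ φ w - φ x := by
    rintro ((rfl | rfl) | h) <;> linarith
  obtain ⟨ha0, hb0⟩ : a * (φ u - φ x) = 0 ∧ b * (φ v - φ x) = 0 :=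
    (add_eq_zero_iff_of_nonneg (mul_nonneg ha (hle u hu)) (mul_nonneg hb (hle v hv))).mp <| by
      linear_combination hcomb - φ x * hab
  obtain hu | hu := hu
  · obtain hv | hv := hv
    · refine absurd ?_ hne
      obtain rfl | rfl := hu <;> obtain rfl | rfl := hv <;> simp_all [Sym2.eq_swap]
    · obtain rfl : b = 0 := (mul_eq_zero.mp hb0).resolve_right (sub_pos.mpr hv).ne'
      obtain rfl : a = 1 := by simpa using hab
      simpa using hu
  · obtain rfl : a = 0 := (mul_eq_zero.mp ha0).resolve_right (sub_pos.mpr hu).ne'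
    obtain rfl : b = 1 := by simpa using hab
    simpa using hv.resolve_right fun hlt => hlt.ne' (by simpa using hcomb)

/-- The map `p` draws `G` with straight edges and without crossings: segments of different edges
meet only in end points. An isolated vertex is not prevented from lying on an edge. -/
structure IsStraightDrawing (G : SimpleGraph V) (p : V → E) : Prop where
  injective : Function.Injective p
  segment_inter_segment_subset : ∀ ⦃a b c d⦄, G.Adj a b → G.Adj c d → s(a, b) ≠ s(c, d) →
    segment ℝ (p a) (p b) ∩ segment ℝ (p c) (p d) ⊆ {p a, p b}

namespace IsStraightDrawing

variable {G : SimpleGraph V} {H : SimpleGraph W}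

theorem isPlanarGraph {p : V → EuclideanSpace ℝ (Fin 2)} (hp : IsStraightDrawing G p)
    (hG : ∀ v, ∃ w, G.Adj v w) : IsPlanarGraph G := by
  choose src tgt hends using fun e : G.edgeSet => Sym2.exists.mp ⟨e.1, rfl⟩
  have hadj (e : G.edgeSet) : G.Adj (src e) (tgt e) := by
    rw [← mem_edgeSet, ← hends]
    exact e.2
  let arc (e : G.edgeSet) : C(unitInterval, EuclideanSpace ℝ (Fin 2)) :=
    ⟨fun t => AffineMap.lineMap (p (src e)) (p (tgt e)) (t : ℝ),
      AffineMap.lineMap_continuous.comp continuous_subtype_val⟩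
  have harc (e) : Function.Injective (arc e) := fun s t hst =>
    Subtype.ext (AffineMap.lineMap_injective ℝ (hp.injective.ne (hadj e).ne) hst)
  have hmem (e) (t) : arc e t ∈ segment ℝ (p (src e)) (p (tgt e)) := by
    rw [segment_eq_image_lineMap]
    exact ⟨t, t.2, rfl⟩
  have hinterior (e) (t : unitInterval) (h0 : 0 < t) (h1 : t < 1) :
      arc e t ∉ ({p (src e), p (tgt e)} : Set _) := by
    rintro (h | h)
    · exact h0.ne' (harc e (h.trans (by simp [arc])))
    · exact h1.ne (harc e (h.trans (by simp [arc])))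
  refine ⟨{
    point := p
    arc := arc
    point_injective := hp.injective
    arc_injective := harc
    arc_endpoints := fun e => by simp [arc, hends e]
    arc_avoids_points := fun e t h0 h1 v hv => hinterior e t h0 h1 ?_
    arcs_disjoint := fun e f hef s t hs0 hs1 _ _ hst => hinterior e s hs0 hs1 <|
      hp.segment_inter_segment_subset (hadj e) (hadj f)
        (by rwa [← hends, ← hends, Subtype.coe_ne_coe]) ⟨hmem e s, hst ▸ hmem f t⟩ }⟩
  obtain ⟨w, hvw⟩ := hG v
  by_cases hv' : s(src e, tgt e) = s(v, w)
  · rw [hv]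
    obtain ⟨h, -⟩ | ⟨-, h⟩ := Sym2.eq_iff.mp hv' <;> simp [h]
  · exact hp.segment_inter_segment_subset (hadj e) hvw hv'
      ⟨hmem e t, hv ▸ left_mem_segment ℝ _ _⟩

theorem comap {p : V → E} (hp : IsStraightDrawing G p) {f : W → V} (hf : f.Injective) :
    IsStraightDrawing (G.comap f) (p ∘ f) where
  injective := hp.injective.comp hf
  segment_inter_segment_subset _ _ _ _ hab hcd hne :=
    hp.segment_inter_segment_subset hab hcd <| (Sym2.map.injective hf).ne hne

theorem const_add {p : V → E} (hp : IsStraightDrawing G p) (c : E) :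
    IsStraightDrawing G fun v => c + p v where
  injective := (add_right_injective c).comp hp.injective
  segment_inter_segment_subset a b a' b' hab hab' hne := by
    simp only [← segment_translate_image, ← Set.image_inter (add_right_injective c)]
    rw [← Set.image_pair]
    exact Set.image_mono (hp.segment_inter_segment_subset hab hab' hne)

theorem sum {p : V → E} {q : W → E} (hp : IsStraightDrawing G p) (hq : IsStraightDrawing H q)
    (φ : E →ₗ[ℝ] ℝ) (c : ℝ) (hpc : ∀ v, φ (p v) < c) (hqc : ∀ w, c < φ (q w)) :
    IsStraightDrawing (G ⊕g H) (Sum.elim p q) where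
  injective := hp.injective.sumElim hq.injective fun v w hvw =>
    ((hpc v).trans (hqc w)).ne (congrArg φ hvw)
  segment_inter_segment_subset := by
    have hdisj (a b c d) : Disjoint (segment ℝ (p a) (p b)) (segment ℝ (q c) (q d)) :=
      disjoint_segment_segment_of_lt φ (hpc a) (hpc b) (hqc c) (hqc d)
    rintro (a | a) (b | b) (c | c) (d | d) hab hcd hne <;>
      try first | cases hab | cases hcd
    · exact hp.segment_inter_segment_subset hab hcd (by simpa using hne)
    · exact (hdisj a b c d).le_bot.trans (Set.empty_subset _)
    · exact (hdisj c d a b).symm.le_bot.trans (Set.empty_subset _)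
    · exact hq.segment_inter_segment_subset hab hcd (by simpa using hne)

end IsStraightDrawing

end StraightDrawing

section QuadFree

/-- There is a graph of order `N` and minimum degree at least `d` in which no two vertices have two
common neighbours, that is, without cycles of length four, and which has a straight-line drawing
in the plane. -/
def ExistsQuadFree (d N : ℕ) : Prop :=
  ∃ (V : Type) (_ : Fintype V) (G : SimpleGraph V) (p : V → EuclideanSpace ℝ (Fin 2)),
    Fintype.card V = N ∧ IsStraightDrawing G p ∧
      (∀ a b, a ≠ b → (G.commonNeighbors a b).Subsingleton) ∧ ∀ v, d ≤ (G.neighborSet v).ncard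

theorem commonNeighbors_sum_subsingleton {V W : Type*} {G : SimpleGraph V} {H : SimpleGraph W}
    (hG : ∀ a b, a ≠ b → (G.commonNeighbors a b).Subsingleton)
    (hH : ∀ a b, a ≠ b → (H.commonNeighbors a b).Subsingleton) (a b : V ⊕ W) (hab : a ≠ b) :
    ((G ⊕g H).commonNeighbors a b).Subsingleton := by
  obtain a | a := a <;> obtain b | b := b <;>
    simp only [SimpleGraph.commonNeighbors, neighborSet_sum_inl, neighborSet_sum_inr]
  · rw [← Set.image_inter Sum.inl_injective]
    exact (hG a b (by simpa using hab)).image _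
  · simp [Set.disjoint_image_inl_image_inr.inter_eq]
  · simp [Set.disjoint_image_inl_image_inr.symm.inter_eq]
  · rw [← Set.image_inter Sum.inr_injective]
    exact (hH a b (by simpa using hab)).image _

theorem ExistsQuadFree.add {d M N : ℕ} (hM : ExistsQuadFree d M) (hN : ExistsQuadFree d N) :
    ExistsQuadFree d (M + N) := by
  obtain ⟨V, _, G, p, hV, hp, hG, hdG⟩ := hM
  obtain ⟨W, _, H, q, hW, hq, hH, hdH⟩ := hN
  let φ : EuclideanSpace ℝ (Fin 2) →L[ℝ] ℝ := EuclideanSpace.proj 0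
  obtain ⟨B, hB⟩ := (Set.finite_range fun v => φ (p v)).bddAbove
  obtain ⟨A, hA⟩ := (Set.finite_range fun w => φ (q w)).bddBelow
  let shift : EuclideanSpace ℝ (Fin 2) := EuclideanSpace.single 0 (B + 2 - A)
  have hleft (v : V) : φ (p v) < B + 1 := (hB ⟨v, rfl⟩).trans_lt (lt_add_one B)
  have hright (w : W) : B + 1 < φ (shift + q w) := by
    have hshift : φ shift = B + 2 - A := by simp [φ, shift]
    rw [map_add, hshift]
    linarith [hA ⟨w, rfl⟩]
  refine ⟨V ⊕ W, inferInstance, G ⊕g H, _, by simp [hV, hW],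
    hp.sum (hq.const_add shift) φ (B + 1) hleft hright,
    commonNeighbors_sum_subsingleton hG hH, ?_⟩
  rintro (v | w)
  · rw [neighborSet_sum_inl, Set.ncard_image_of_injective _ Sum.inl_injective]
    exact hdG v
  · rw [neighborSet_sum_inr, Set.ncard_image_of_injective _ Sum.inr_injective]
    exact hdH w

theorem ExistsQuadFree.card_add_lt_planarRamsey {W : Type*} [Fintype W] (H : SimpleGraph W)
    {d : ℕ} (hd : 0 < d) (h : ExistsQuadFree d (Fintype.card W + d)) :
    Fintype.card W + d < planarRamsey (cycleGraph 4) (coneGraph H) := by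
  obtain ⟨V, _, G, p, hV, hp, hG, hdeg⟩ := h
  have hnbr (v : V) : ∃ w, G.Adj v w :=
    Set.nonempty_of_ncard_ne_zero (hd.trans_le (hdeg v)).ne'
  rw [← hV]
  exact card_lt_planarRamsey (hp.isPlanarGraph hnbr)
    (cycleGraph_four_free_of_commonNeighbors_subsingleton hG)
    (coneGraph_free_compl H hV.le hdeg)

end QuadFree

section Trails

/-- The point of the integer grid `ℕ × {0, …, 15}` with label `k`. -/
noncomputable def gridPoint (k : ℕ) : EuclideanSpace ℝ (Fin 2) :=
  !₂[((k / 16 : ℕ) : ℝ), ((k % 16 : ℕ) : ℝ)]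

theorem gridPoint_apply_zero (k : ℕ) : gridPoint k 0 = ((k / 16 : ℕ) : ℝ) := rfl

theorem gridPoint_apply_one (k : ℕ) : gridPoint k 1 = ((k % 16 : ℕ) : ℝ) := rfl

theorem gridPoint_injective : Function.Injective gridPoint := by
  intro k l h
  have hx : k / 16 = l / 16 := Nat.cast_injective (R := ℝ) (congrArg (fun z => z 0) h)
  have hy : k % 16 = l % 16 := Nat.cast_injective (R := ℝ) (congrArg (fun z => z 1) h)
  rw [← Nat.div_add_mod k 16, hx, hy, Nat.div_add_mod]

/-- The grid point with label `c` is `a` or `b` or lies strictly to the left of the directed line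
from `a` to `b`; the two sides of the inequality are the positive and the negative terms of the
determinant of `b - a` and `c - a`. It is a Boolean on accelerated operations because it is
evaluated some `10 ^ 5` times. -/
def liesLeft (a b c : ℕ) : Bool :=
  (Nat.beq c a || Nat.beq c b) ||
    Nat.blt (a % 16 * (b / 16) + b % 16 * (c / 16) + c % 16 * (a / 16))
      (a / 16 * (b % 16) + b / 16 * (c % 16) + c / 16 * (a % 16))

/-- A sufficient condition for the segments `e` and `f`, given by the labels of their end points
in increasing order, to meet at most in end points: one of them follows the other in the order of
labels, or one of them lies on one side of the line through the other. -/
def NonCrossing (e f : ℕ × ℕ) : Prop :=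
  Nat.blt e.2 f.1 || (Nat.blt f.2 e.1 ||
    (liesLeft e.1 e.2 f.1 && liesLeft e.1 e.2 f.2 ||
    (liesLeft e.2 e.1 f.1 && liesLeft e.2 e.1 f.2 ||
    (liesLeft f.1 f.2 e.1 && liesLeft f.1 f.2 e.2 ||
    liesLeft f.2 f.1 e.1 && liesLeft f.2 f.1 e.2))))

instance (e f : ℕ × ℕ) : Decidable (NonCrossing e f) := inferInstanceAs (Decidable (_ = true))

instance : Std.Symm NonCrossing where
  symm e f h := by
    simp only [NonCrossing, Bool.or_eq_true] at h ⊢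
    tauto

theorem segment_inter_segment_subset_of_liesLeft {a b c d : ℕ} (hc : liesLeft a b c)
    (hd : liesLeft a b d) (hcd : c ≠ d) (hne : s(a, b) ≠ s(c, d)) :
    segment ℝ (gridPoint a) (gridPoint b) ∩ segment ℝ (gridPoint c) (gridPoint d) ⊆
      {gridPoint a, gridPoint b} ∩ {gridPoint c, gridPoint d} := by
  let φ : EuclideanSpace ℝ (Fin 2) →L[ℝ] ℝ :=
    (gridPoint b 0 - gridPoint a 0) • EuclideanSpace.proj 1 -
      (gridPoint b 1 - gridPoint a 1) • EuclideanSpace.proj 0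
  have hφ (z) : φ z = (gridPoint b 0 - gridPoint a 0) * z 1 -
      (gridPoint b 1 - gridPoint a 1) * z 0 := by simp [φ]
  have hleft (k : ℕ) (hk : liesLeft a b k) :
      gridPoint k ∈ ({gridPoint a, gridPoint b} : Set _) ∨ φ (gridPoint a) < φ (gridPoint k) := by
    simp only [liesLeft, Bool.or_eq_true, Nat.beq_eq, Nat.blt_eq] at hk
    refine hk.imp (Or.imp (congrArg gridPoint) (congrArg gridPoint)) fun hdet => ?_
    have hdet' : gridPoint a 1 * gridPoint b 0 + gridPoint b 1 * gridPoint k 0 +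
        gridPoint k 1 * gridPoint a 0 < gridPoint a 0 * gridPoint b 1 +
        gridPoint b 0 * gridPoint k 1 + gridPoint k 0 * gridPoint a 1 := by
      simp only [gridPoint_apply_zero, gridPoint_apply_one]
      exact_mod_cast hdet
    rw [hφ, hφ]
    linarith
  exact segment_inter_segment_subset_of_le φ (by simp only [ContinuousLinearMap.coe_coe, hφ]; ring)
    (hleft c hc) (hleft d hd) (gridPoint_injective.ne hcd)
    fun h => hne (Sym2.map.injective gridPoint_injective h)

theorem disjoint_segment_segment_of_label_lt {a b c d : ℕ} (hab : a ≤ b) (hbc : b < c)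
    (hcd : c ≤ d) :
    Disjoint (segment ℝ (gridPoint a) (gridPoint b)) (segment ℝ (gridPoint c) (gridPoint d)) := by
  let φ : EuclideanSpace ℝ (Fin 2) →L[ℝ] ℝ :=
    (16 : ℝ) • EuclideanSpace.proj 0 + EuclideanSpace.proj 1
  have hφ (k : ℕ) : φ (gridPoint k) = k := by
    have hk : φ (gridPoint k) = 16 * gridPoint k 0 + gridPoint k 1 := by simp [φ]
    rw [hk, gridPoint_apply_zero, gridPoint_apply_one]
    exact_mod_cast Nat.div_add_mod k 16
  have hle (k l : ℕ) (hkl : k ≤ l) : (k : ℝ) ≤ l := Nat.cast_le.mpr hkl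
  refine disjoint_segment_segment_of_lt φ (c := b + 1 / 2) ?_ ?_ ?_ ?_ <;>
    simp only [ContinuousLinearMap.coe_coe, hφ]
  · linarith [hle a b hab]
  · linarith
  · linarith [hle (b + 1) c hbc, Nat.cast_succ (R := ℝ) b]
  · linarith [hle (b + 1) d (hbc.trans_le hcd), Nat.cast_succ (R := ℝ) b]

theorem NonCrossing.segment_inter_segment_subset {e f : ℕ × ℕ} (h : NonCrossing e f)
    (he : e.1 < e.2) (hf : f.1 < f.2) (hef : e ≠ f) :
    segment ℝ (gridPoint e.1) (gridPoint e.2) ∩ segment ℝ (gridPoint f.1) (gridPoint f.2) ⊆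
      {gridPoint e.1, gridPoint e.2} := by
  have hne : s(e.1, e.2) ≠ s(f.1, f.2) := by
    simp only [ne_eq, Sym2.eq_iff, Prod.ext_iff] at hef ⊢
    omega
  simp only [NonCrossing, Bool.or_eq_true, Bool.and_eq_true, Nat.blt_eq] at h
  obtain hlt | hlt | ⟨h₁, h₂⟩ | ⟨h₁, h₂⟩ | ⟨h₁, h₂⟩ | ⟨h₁, h₂⟩ := h
  · exact (disjoint_segment_segment_of_label_lt he.le hlt hf.le).le_bot.trans (Set.empty_subset _)
  · exact (disjoint_segment_segment_of_label_lt hf.le hlt he.le).symm.le_bot.trans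
      (Set.empty_subset _)
  · exact (segment_inter_segment_subset_of_liesLeft h₁ h₂ hf.ne hne).trans Set.inter_subset_left
  · rw [segment_symm, Set.pair_comm]
    exact (segment_inter_segment_subset_of_liesLeft h₁ h₂ hf.ne (by rwa [Sym2.eq_swap])).trans
      Set.inter_subset_left
  · rw [Set.inter_comm]
    exact (segment_inter_segment_subset_of_liesLeft h₁ h₂ he.ne hne.symm).trans
      Set.inter_subset_right
  · rw [Set.inter_comm, segment_symm ℝ (gridPoint f.1)]
    exact (segment_inter_segment_subset_of_liesLeft h₁ h₂ he.ne
      (by rw [Sym2.eq_swap]; exact hne.symm)).trans Set.inter_subset_right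

/-- The edges of the trails in the list `T`, each with its smaller end first. -/
def trailEdges (T : List (List ℕ)) : List (ℕ × ℕ) :=
  T.flatMap fun t => (t.zip t.tail).map fun e => (min e.1 e.2, max e.1 e.2)

/-- The graph traversed by the trails in the list `T`, on all of `ℕ`. -/
def trailGraph (T : List (List ℕ)) : SimpleGraph ℕ :=
  SimpleGraph.fromRel fun a b => (a, b) ∈ trailEdges T

/-- The neighbours of `a` in `trailGraph T`, as a list. -/
def trailNeighbors (T : List (List ℕ)) (a : ℕ) : List ℕ :=
  (trailEdges T).filterMap fun e =>
    if e.1 = a then some e.2 else if e.2 = a then some e.1 else none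

/-- The codes `Nat.pair x y` of the pairs `x < y` of neighbours of `a`. -/
def neighborPairs (T : List (List ℕ)) (a : ℕ) : List ℕ :=
  (trailNeighbors T a).flatMap fun x =>
    ((trailNeighbors T a).filter (x < ·)).map (Nat.pair x)

/-- The entries of the list are distinct and none of them is the position of a bit of `m`. Keeping
the entries already seen in one number is what makes this fast to evaluate. -/
def distinctAvoiding (m : ℕ) : List ℕ → Bool
  | [] => true
  | c :: l => !m.testBit c && distinctAvoiding (m ||| 2 ^ c) l

theorem nodup_of_distinctAvoiding {m : ℕ} {l : List ℕ} (h : distinctAvoiding m l) :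
    l.Nodup ∧ ∀ c ∈ l, m.testBit c = false := by
  induction l generalizing m with
  | nil => simp
  | cons c l ih =>
    simp only [distinctAvoiding, Bool.and_eq_true, Bool.not_eq_true'] at h
    obtain ⟨hnodup, havoid⟩ := ih h.2
    simp only [Nat.testBit_or, Bool.or_eq_false_iff] at havoid
    refine ⟨List.nodup_cons.mpr ⟨fun hc => ?_, hnodup⟩, List.forall_mem_cons.mpr
      ⟨h.1, fun x hx => (havoid x hx).1⟩⟩
    simpa using (havoid c hc).2

theorem le_and_mem_flatten_of_mem_trailEdges {T : List (List ℕ)} {a b : ℕ}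
    (h : (a, b) ∈ trailEdges T) : a ≤ b ∧ a ∈ T.flatten ∧ b ∈ T.flatten := by
  simp only [trailEdges, List.mem_flatMap, List.mem_map] at h
  obtain ⟨t, ht, e, he, hab⟩ := h
  have hmem (c : ℕ) (hc : c = e.1 ∨ c = e.2) : c ∈ T.flatten := by
    refine List.mem_flatten.mpr ⟨t, ht, ?_⟩
    obtain rfl | rfl := hc
    · exact (List.of_mem_zip he).1
    · exact List.mem_of_mem_tail (List.of_mem_zip he).2
  obtain ⟨rfl, rfl⟩ := Prod.mk.inj hab
  exact ⟨min_le_max, hmem _ (min_choice _ _), hmem _ (max_choice _ _)⟩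

theorem mem_trailNeighbors {T : List (List ℕ)} {a b : ℕ} :
    b ∈ trailNeighbors T a ↔ (a, b) ∈ trailEdges T ∨ (b, a) ∈ trailEdges T := by
  simp only [trailNeighbors, List.mem_filterMap, Prod.exists]
  constructor
  · rintro ⟨x, y, hxy, h⟩
    split_ifs at h <;> simp_all
  · rintro (h | h)
    · exact ⟨a, b, h, by simp⟩
    · refine ⟨b, a, h, ?_⟩
      split_ifs <;> simp_all

theorem trailGraph_adj {T : List (List ℕ)} {a b : ℕ} :
    (trailGraph T).Adj a b ↔ a ≠ b ∧ b ∈ trailNeighbors T a := by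
  rw [trailGraph, fromRel_adj, mem_trailNeighbors]

theorem mem_flatten_of_trailGraph_adj {T : List (List ℕ)} {a b : ℕ}
    (hab : (trailGraph T).Adj a b) : a ∈ T.flatten := by
  obtain ⟨-, h | h⟩ := hab
  · exact (le_and_mem_flatten_of_mem_trailEdges h).2.1
  · exact (le_and_mem_flatten_of_mem_trailEdges h).2.2

theorem isStraightDrawing_trailGraph {T : List (List ℕ)}
    (hT : (trailEdges T).Pairwise NonCrossing) : IsStraightDrawing (trailGraph T) gridPoint where
  injective := gridPoint_injective
  segment_inter_segment_subset a b c d hab hcd hne := by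
    have hcross {a b c d : ℕ} (hab : a ≠ b) (he : (a, b) ∈ trailEdges T) (hcd : c ≠ d)
        (hf : (c, d) ∈ trailEdges T) (hne : s(a, b) ≠ s(c, d)) :
        segment ℝ (gridPoint a) (gridPoint b) ∩ segment ℝ (gridPoint c) (gridPoint d) ⊆
          {gridPoint a, gridPoint b} := by
      have hef : (a, b) ≠ (c, d) := fun h => hne (congrArg (fun e => s(e.1, e.2)) h)
      exact (hT.forall he hf hef).segment_inter_segment_subset
        ((le_and_mem_flatten_of_mem_trailEdges he).1.lt_of_ne hab)
        ((le_and_mem_flatten_of_mem_trailEdges hf).1.lt_of_ne hcd) hef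
    obtain ⟨hab', he | he⟩ := hab <;> obtain ⟨hcd', hf | hf⟩ := hcd
    · exact hcross hab' he hcd' hf hne
    · rw [segment_symm ℝ (gridPoint c)]
      exact hcross hab' he hcd'.symm hf (by rwa [Sym2.eq_swap (a := d)])
    · rw [segment_symm ℝ (gridPoint a), Set.pair_comm]
      exact hcross hab'.symm he hcd' hf (by rwa [Sym2.eq_swap])
    · rw [segment_symm ℝ (gridPoint a), segment_symm ℝ (gridPoint c), Set.pair_comm]
      exact hcross hab'.symm he hcd'.symm hf (by rwa [Sym2.eq_swap, Sym2.eq_swap (a := d)])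

theorem mem_neighborPairs {T : List (List ℕ)} {a x y : ℕ} (hxy : x < y)
    (hx : (trailGraph T).Adj a x) (hy : (trailGraph T).Adj a y) :
    Nat.pair x y ∈ neighborPairs T a :=
  List.mem_flatMap.mpr ⟨x, (trailGraph_adj.mp hx).2, List.mem_map_of_mem <|
    List.mem_filter.mpr ⟨(trailGraph_adj.mp hy).2, decide_eq_true hxy⟩⟩

theorem commonNeighbors_trailGraph_subsingleton {T : List (List ℕ)}
    (hT : (T.flatten.dedup.flatMap (neighborPairs T)).Nodup) {a b : ℕ} (hab : a ≠ b) :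
    ((trailGraph T).commonNeighbors a b).Subsingleton := by
  have hmem {c x : ℕ} (hcx : (trailGraph T).Adj c x) : c ∈ T.flatten.dedup :=
    List.mem_dedup.mpr (mem_flatten_of_trailGraph_adj hcx)
  have : Std.Symm (Function.onFun List.Disjoint (neighborPairs T)) := ⟨fun _ _ h => h.symm⟩
  have hnotlt {x y : ℕ} (hx : x ∈ (trailGraph T).commonNeighbors a b)
      (hy : y ∈ (trailGraph T).commonNeighbors a b) : ¬x < y := fun hxy =>
    (List.nodup_flatMap.mp hT).2.forall (hmem hx.1) (hmem hx.2) hab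
      (mem_neighborPairs hxy hx.1 hy.1) (mem_neighborPairs hxy hx.2 hy.2)
  exact fun x hx y hy => le_antisymm (not_lt.mp (hnotlt hy hx)) (not_lt.mp (hnotlt hx hy))

/-- A decidable certificate for the trails of `T` to traverse a plane graph of order `N` and minimum
degree at least `d` without cycles of length four. -/
def IsQuadFreeChart (d N : ℕ) (T : List (List ℕ)) : Prop :=
  T.flatten.dedup.length = N ∧ (trailEdges T).Pairwise NonCrossing ∧
    (∀ a ∈ T.flatten.dedup, d ≤ ((trailNeighbors T a).toFinset.erase a).card) ∧
    distinctAvoiding 0 (T.flatten.dedup.flatMap (neighborPairs T))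

instance (d N : ℕ) (T : List (List ℕ)) : Decidable (IsQuadFreeChart d N T) :=
  inferInstanceAs (Decidable (_ ∧ _))

theorem IsQuadFreeChart.existsQuadFree {d N : ℕ} {T : List (List ℕ)} (h : IsQuadFreeChart d N T) :
    ExistsQuadFree d N := by
  obtain ⟨hcard, hcross, hdeg, hpairs⟩ := h
  let vertices := T.flatten.toFinset
  let G : SimpleGraph vertices := (trailGraph T).comap (↑)
  have hnbr (v : vertices) : ((trailNeighbors T v).toFinset.erase v : Set ℕ) ⊆
      (↑) '' G.neighborSet v := by
    intro x hx
    rw [Finset.mem_coe, Finset.mem_erase, List.mem_toFinset] at hx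
    have hadj : (trailGraph T).Adj v x := trailGraph_adj.mpr ⟨hx.1.symm, hx.2⟩
    exact ⟨⟨x, List.mem_toFinset.mpr (mem_flatten_of_trailGraph_adj hadj.symm)⟩, hadj, rfl⟩
  refine ⟨vertices, inferInstance, G, _, by simpa [vertices, List.card_toFinset] using hcard,
    (isStraightDrawing_trailGraph hcross).comap Subtype.val_injective, fun a b hab => ?_,
    fun v => ?_⟩
  · exact fun x hx y hy => Subtype.ext <| commonNeighbors_trailGraph_subsingleton
      (nodup_of_distinctAvoiding hpairs).1 (Subtype.coe_ne_coe.mpr hab) hx hy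
  · calc d ≤ ((trailNeighbors T v).toFinset.erase v).card :=
          hdeg v (List.mem_dedup.mpr (List.mem_toFinset.mp v.2))
      _ ≤ ((↑) '' G.neighborSet v : Set ℕ).ncard := by
        rw [← Set.ncard_coe_finset]
        exact Set.ncard_le_ncard (hnbr v)
      _ = (G.neighborSet v).ncard := Set.ncard_image_of_injective _ Subtype.val_injective

end Trails

section Examples

theorem existsQuadFree_three_10 : ExistsQuadFree 3 10 :=
  IsQuadFreeChart.existsQuadFree (T :=
    [[65, 51], [50, 49, 65, 32, 49], [33, 50, 34, 51, 3], [18, 32, 1, 18, 33, 34, 3, 1]])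
      (by decide +kernel)

theorem existsQuadFree_three_11 : ExistsQuadFree 3 11 :=
  IsQuadFreeChart.existsQuadFree (T :=
    [[65, 51], [34, 50, 65, 32], [33, 50, 51, 19], [49, 33, 34, 17, 19, 2, 17], [16, 49, 32, 16,
      2]]) (by decide +kernel)

theorem existsQuadFree_three_12 : ExistsQuadFree 3 12 :=
  IsQuadFreeChart.existsQuadFree (T :=
    [[66, 65], [52, 66, 50], [35, 33], [51, 52, 20], [18, 35, 51, 20, 1], [19, 18, 33, 50, 65, 0,
      19, 1, 0]]) (by decide +kernel)

theorem existsQuadFree_three_13 : ExistsQuadFree 3 13 :=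
  IsQuadFreeChart.existsQuadFree (T :=
    [[66, 65], [51, 66, 50], [49, 50, 65, 32], [34, 51, 3, 34, 49, 18], [33, 18, 17], [16, 33, 32,
      16, 1, 17, 3, 1]]) (by decide +kernel)

theorem existsQuadFree_three_14 : ExistsQuadFree 3 14 :=
  IsQuadFreeChart.existsQuadFree (T :=
    [[67, 66], [51, 67, 36], [48, 66, 33], [50, 34, 33, 48, 32], [19, 34, 17], [18, 19, 50, 51, 36,
      4, 18, 1, 32, 17, 1, 4]]) (by decide +kernel)

theorem existsQuadFree_three_15 : ExistsQuadFree 3 15 :=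
  IsQuadFreeChart.existsQuadFree (T :=
    [[68, 65], [52, 68, 35], [49, 33], [50, 65, 32], [51, 50, 34, 33, 19], [17, 19, 34, 51, 35, 52,
      3], [16, 49, 32, 16, 2, 17, 3, 2]]) (by decide +kernel)

theorem existsQuadFree_three_16 : ExistsQuadFree 3 16 :=
  IsQuadFreeChart.existsQuadFree (T :=
    [[83, 80], [66, 83, 65], [67, 66, 50], [51, 50, 67, 36], [64, 80, 65, 34], [35, 51, 34, 35, 18],
      [19, 36, 4], [33, 64, 1, 33, 18, 19, 4, 1]]) (by decide +kernel)

theorem existsQuadFree_three_17 : ExistsQuadFree 3 17 :=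
  IsQuadFreeChart.existsQuadFree (T :=
    [[83, 81], [68, 83, 66, 67], [34, 67, 33], [65, 33, 66, 81, 32], [51, 68, 20], [35, 34, 18],
      [17, 18, 35, 51, 20, 3], [16, 65, 32, 16, 2, 17, 3, 2]]) (by decide +kernel)

theorem existsQuadFree_three_18 : ExistsQuadFree 3 18 :=
  IsQuadFreeChart.existsQuadFree (T :=
    [[83, 81], [66, 83, 52], [67, 50], [65, 66, 81, 48], [49, 65, 50, 49, 34], [35, 19], [32, 48,
      17], [20, 67, 52, 20, 2], [18, 35, 34, 18, 17, 32, 1, 19, 2, 1]]) (by decide +kernel)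

theorem existsQuadFree_three_19 : ExistsQuadFree 3 19 :=
  IsQuadFreeChart.existsQuadFree (T :=
    [[82, 80], [69, 82, 68], [67, 52, 51], [50, 67, 68, 80, 49], [66, 33], [36, 69, 21], [35, 51,
      17, 66, 50, 17], [20, 35, 52, 36, 21, 3], [32, 49, 33, 32, 1, 20, 3, 1]]) (by decide +kernel)

theorem existsQuadFree_four_30 : ExistsQuadFree 4 30 :=
  IsQuadFreeChart.existsQuadFree (T :=
    [[0, 112, 147, 151, 133, 147, 131, 132, 117, 133, 118, 85, 70, 151, 7, 70, 54, 85, 84, 118, 117,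
      99, 114, 68, 84, 53, 68, 99, 132, 113, 67, 114, 52, 50, 35, 53, 36, 54, 21, 36, 35, 52, 67,
      66, 113, 131, 112, 49, 66, 17, 50, 34, 21, 20, 34, 17, 49, 0, 20, 7, 0]]) (by decide +kernel)

theorem existsQuadFree_four_36 : ExistsQuadFree 4 36 :=
  IsQuadFreeChart.existsQuadFree (T :=
    [[0, 144, 150, 136, 103, 150, 131, 134, 118, 103, 69, 87, 55, 136, 40, 55, 38, 87, 54, 69, 118,
      85, 134, 117, 129, 116, 117, 131, 144, 65, 129, 98, 115, 99, 116, 101, 85, 83, 68, 67, 52, 51,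
      38, 52, 68, 54, 83, 101, 99, 50, 67, 34, 36, 51, 22, 40, 5, 22, 36, 19, 34, 50, 115, 33, 19,
      18, 33, 98, 65, 0, 18, 5, 0]]) (by decide +kernel)

theorem existsQuadFree_four_39 : ExistsQuadFree 4 39 :=
  IsQuadFreeChart.existsQuadFree (T :=
    [[0, 128, 165, 167, 153, 104, 167, 134, 151, 135, 104, 88, 135, 102, 151, 118, 134, 165, 148,
      149, 131, 130, 117, 116, 101, 87, 88, 54, 72, 153, 9, 72, 55, 54, 87, 116, 102, 117, 131, 118,
      149, 129, 114, 68, 130, 84, 101, 70, 84, 68, 67, 114, 82, 129, 148, 128, 113, 97, 35, 67, 53,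
      70, 37, 55, 24, 37, 53, 35, 34, 24, 22, 34, 97, 82, 113, 0, 22, 9, 0]]) (by decide +kernel)

theorem existsQuadFree_four_42 : ExistsQuadFree 4 42 :=
  IsQuadFreeChart.existsQuadFree (T :=
    [[1, 34, 65, 51, 97, 48, 161, 149, 146, 136, 134, 121, 136, 149, 138, 73, 121, 88, 73, 10, 138,
      161, 145, 115, 146, 133, 119, 134, 120, 119, 101, 133, 115, 98, 116, 101, 84, 102, 103, 120,
      71, 88, 57, 71, 103, 70, 69, 56, 57, 23, 56, 70, 102, 85, 84, 116, 82, 98, 145, 48, 16, 97,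
      82, 51, 35, 85, 36, 69, 55, 36, 35, 65, 19, 55, 38, 23, 20, 38, 19, 34, 16, 1, 20, 10, 1]])
      (by decide +kernel)

theorem existsQuadFree_four_44 : ExistsQuadFree 4 44 :=
  IsQuadFreeChart.existsQuadFree (T :=
    [[0, 176, 186, 163, 161, 149, 168, 137, 186, 26, 137, 121, 152, 117, 135, 118, 103, 121, 88, 72,
      73, 26, 6, 73, 55, 56, 36, 55, 72, 121, 168, 133, 149, 163, 176, 145, 98, 161, 130, 147, 131,
      100, 135, 83, 118, 87, 102, 101, 83, 68, 101, 52, 102, 69, 88, 54, 69, 87, 103, 152, 116, 147,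
      133, 116, 117, 100, 82, 131, 130, 98, 81, 82, 68, 81, 66, 52, 35, 54, 36, 35, 66, 19, 56, 20,
      19, 81, 145, 0, 20, 6, 0]]) (by decide +kernel)

theorem existsQuadFree_four_45 : ExistsQuadFree 4 45 :=
  IsQuadFreeChart.existsQuadFree (T :=
    [[0, 177, 187, 164, 163, 149, 130, 163, 150, 170, 151, 134, 136, 153, 137, 170, 122, 187, 123,
      122, 137, 87, 121, 40, 123, 7, 40, 23, 121, 88, 87, 153, 103, 136, 101, 100, 86, 119, 103, 54,
      88, 39, 54, 119, 70, 86, 101, 134, 116, 149, 132, 116, 151, 150, 164, 177, 49, 130, 114, 83,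
      132, 67, 100, 85, 69, 70, 52, 69, 50, 51, 38, 52, 39, 38, 23, 51, 22, 50, 85, 67, 83, 33, 22,
      19, 33, 114, 49, 0, 19, 7, 0]]) (by decide +kernel)

theorem existsQuadFree_four_46 : ExistsQuadFree 4 46 :=
  IsQuadFreeChart.existsQuadFree (T :=
    [[8, 35, 49, 131, 81, 147, 130, 163, 151, 169, 152, 138, 169, 166, 187, 178, 166, 151, 149, 163,
      145, 178, 128, 145, 130, 81, 65, 128, 16, 65, 131, 115, 68, 147, 84, 149, 133, 152, 137, 118,
      104, 138, 105, 122, 187, 11, 122, 90, 73, 58, 40, 73, 55, 90, 105, 104, 72, 118, 117, 102, 86,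
      72, 55, 86, 53, 102, 68, 117, 137, 133, 84, 68, 66, 50, 38, 53, 40, 38, 66, 115, 49, 22, 50,
      23, 58, 41, 23, 22, 35, 16, 8, 41, 11, 8]]) (by decide +kernel)

theorem existsQuadFree_four_47 : ExistsQuadFree 4 47 :=
  IsQuadFreeChart.existsQuadFree (T :=
    [[0, 192, 203, 184, 181, 170, 122, 105, 170, 184, 171, 41, 122, 24, 41, 10, 171, 203, 180, 163,
      181, 150, 169, 120, 105, 169, 151, 136, 103, 120, 89, 103, 102, 136, 118, 151, 150, 163, 148,
      134, 163, 161, 147, 115, 148, 132, 133, 117, 134, 118, 117, 84, 102, 87, 84, 133, 83, 69, 87,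
      70, 89, 40, 24, 89, 39, 70, 69, 54, 83, 132, 115, 66, 54, 50, 66, 147, 114, 161, 180, 192, 65,
      114, 49, 37, 50, 39, 37, 18, 40, 19, 18, 49, 65, 0, 19, 10, 0]]) (by decide +kernel)

theorem existsQuadFree_four_48 : ExistsQuadFree 4 48 :=
  IsQuadFreeChart.existsQuadFree (T :=
    [[1, 80, 176, 187, 167, 165, 147, 146, 165, 148, 168, 154, 187, 43, 154, 106, 168, 132, 134,
      151, 120, 135, 104, 103, 118, 151, 106, 120, 74, 135, 89, 104, 86, 88, 72, 89, 39, 57, 74, 25,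
      43, 8, 25, 57, 22, 37, 21, 22, 39, 72, 36, 88, 53, 86, 103, 68, 118, 134, 101, 147, 116, 101,
      132, 148, 167, 176, 129, 146, 115, 113, 65, 35, 113, 98, 116, 82, 68, 51, 53, 35, 51, 82, 98,
      115, 129, 80, 34, 65, 19, 37, 36, 19, 34, 1, 21, 8, 1]]) (by decide +kernel)

theorem existsQuadFree_four_49 : ExistsQuadFree 4 49 :=
  IsQuadFreeChart.existsQuadFree (T :=
    [[1, 48, 176, 187, 165, 162, 149, 168, 154, 187, 43, 154, 137, 168, 135, 148, 146, 162, 129,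
      146, 131, 148, 120, 133, 118, 131, 130, 117, 116, 129, 99, 116, 130, 118, 102, 87, 118, 89,
      133, 104, 137, 122, 90, 43, 9, 90, 41, 103, 40, 87, 54, 85, 67, 102, 84, 117, 100, 82, 51, 85,
      36, 54, 40, 25, 39, 23, 25, 103, 89, 41, 122, 104, 120, 135, 149, 165, 176, 113, 99, 81, 100,
      84, 67, 51, 49, 82, 81, 113, 48, 34, 49, 22, 39, 36, 22, 34, 1, 23, 9, 1]])
      (by decide +kernel)

theorem existsQuadFree_four_50 : ExistsQuadFree 4 50 :=
  IsQuadFreeChart.existsQuadFree (T :=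
    [[1, 80, 192, 201, 187, 106, 201, 181, 184, 153, 106, 74, 153, 137, 184, 166, 177, 152, 166,
      181, 192, 113, 177, 130, 163, 164, 152, 151, 137, 120, 148, 105, 132, 118, 103, 85, 117, 116,
      132, 83, 116, 67, 117, 84, 85, 118, 105, 104, 72, 103, 87, 72, 58, 187, 11, 58, 104, 74, 105,
      120, 151, 164, 98, 148, 115, 83, 66, 115, 98, 163, 65, 66, 36, 67, 53, 55, 84, 41, 87, 26, 39,
      24, 26, 41, 55, 38, 53, 36, 65, 130, 113, 80, 34, 65, 20, 39, 38, 20, 34, 1, 24, 11, 1]])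
      (by decide +kernel)

theorem existsQuadFree_four_51 : ExistsQuadFree 4 51 :=
  IsQuadFreeChart.existsQuadFree (T :=
    [[3, 48, 176, 187, 163, 162, 151, 169, 138, 153, 120, 150, 147, 134, 119, 105, 134, 150, 136,
      169, 139, 187, 108, 139, 138, 91, 153, 106, 88, 105, 103, 72, 86, 119, 69, 86, 55, 72, 57,
      103, 88, 74, 106, 120, 136, 151, 163, 176, 129, 146, 162, 116, 147, 118, 116, 146, 100, 113,
      97, 66, 113, 83, 118, 84, 69, 53, 66, 36, 56, 55, 36, 53, 84, 83, 100, 129, 48, 34, 97, 19,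
      56, 20, 57, 39, 41, 74, 25, 91, 42, 108, 11, 42, 25, 41, 23, 39, 20, 19, 34, 3, 23, 11, 3]])
      (by decide +kernel)

theorem existsQuadFree_four_52 : ExistsQuadFree 4 52 :=
  IsQuadFreeChart.existsQuadFree (T :=
    [[1, 32, 192, 203, 184, 172, 203, 181, 178, 167, 150, 178, 168, 153, 184, 139, 153, 121, 168,
      181, 192, 161, 177, 163, 148, 131, 117, 134, 167, 152, 136, 135, 104, 134, 152, 121, 136, 89,
      139, 106, 107, 172, 12, 107, 27, 106, 89, 135, 58, 104, 117, 148, 146, 100, 71, 131, 87, 58,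
      42, 27, 58, 41, 87, 71, 70, 100, 69, 146, 163, 150, 177, 98, 115, 84, 66, 52, 70, 54, 41, 37,
      51, 66, 35, 51, 22, 42, 23, 22, 37, 54, 52, 84, 69, 115, 49, 35, 20, 49, 98, 161, 32, 20, 1,
      23, 12, 1]]) (by decide +kernel)

theorem existsQuadFree_four_53 : ExistsQuadFree 4 53 :=
  IsQuadFreeChart.existsQuadFree (T :=
    [[2, 48, 192, 200, 180, 177, 166, 181, 169, 200, 171, 169, 154, 181, 153, 150, 165, 177, 162,
      148, 133, 114, 116, 86, 84, 116, 98, 114, 148, 177, 149, 165, 119, 150, 137, 135, 104, 154,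
      121, 104, 137, 153, 166, 180, 192, 145, 162, 81, 99, 66, 84, 51, 68, 69, 86, 55, 133, 71, 149,
      118, 134, 119, 72, 135, 88, 42, 121, 58, 171, 11, 58, 42, 25, 88, 72, 134, 40, 118, 71, 55,
      69, 40, 39, 25, 40, 68, 38, 51, 66, 49, 50, 38, 21, 39, 22, 21, 50, 20, 49, 99, 98, 81, 145,
      48, 20, 2, 22, 11, 2]]) (by decide +kernel)

theorem existsQuadFree_four_54 : ExistsQuadFree 4 54 :=
  IsQuadFreeChart.existsQuadFree (T :=
    [[0, 49, 65, 147, 164, 149, 118, 132, 148, 131, 164, 150, 166, 179, 167, 186, 169, 151, 186,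
      184, 203, 195, 184, 167, 166, 135, 151, 136, 152, 121, 169, 138, 203, 27, 138, 121, 74, 152,
      105, 149, 150, 135, 136, 105, 118, 89, 117, 102, 74, 58, 41, 27, 10, 41, 20, 58, 102, 89, 132,
      99, 71, 117, 56, 57, 38, 20, 57, 37, 56, 71, 70, 84, 55, 70, 99, 148, 66, 131, 147, 114, 179,
      130, 195, 16, 130, 114, 65, 34, 69, 35, 55, 37, 35, 17, 38, 18, 17, 69, 51, 84, 66, 51, 34,
      49, 16, 0, 18, 10, 0]]) (by decide +kernel)

theorem existsQuadFree_four_55 : ExistsQuadFree 4 55 :=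
  IsQuadFreeChart.existsQuadFree (T :=
    [[4, 32, 176, 211, 198, 196, 186, 198, 188, 211, 194, 184, 196, 185, 184, 167, 178, 145, 115,
      178, 163, 152, 185, 136, 169, 186, 91, 169, 122, 136, 152, 150, 135, 119, 104, 135, 121, 122,
      105, 106, 91, 43, 188, 12, 43, 106, 58, 104, 27, 58, 105, 121, 150, 132, 115, 99, 132, 103,
      150, 163, 167, 194, 176, 81, 145, 114, 98, 53, 99, 84, 116, 103, 72, 119, 42, 72, 116, 85, 71,
      56, 39, 27, 26, 39, 21, 56, 42, 71, 38, 85, 84, 53, 51, 98, 65, 50, 37, 51, 38, 37, 21, 50,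
      19, 65, 114, 81, 32, 19, 4, 26, 12, 4]]) (by decide +kernel)

theorem existsQuadFree_four_56 : ExistsQuadFree 4 56 :=
  IsQuadFreeChart.existsQuadFree (T :=
    [[6, 34, 49, 130, 162, 100, 178, 148, 194, 181, 195, 198, 219, 204, 123, 219, 208, 198, 183,
      202, 186, 153, 122, 107, 204, 12, 107, 153, 136, 186, 123, 202, 169, 183, 195, 182, 168, 169,
      151, 136, 120, 151, 168, 133, 182, 181, 148, 132, 133, 119, 120, 103, 122, 89, 103, 119, 132,
      117, 73, 89, 59, 73, 132, 178, 147, 101, 85, 99, 100, 147, 71, 117, 58, 71, 101, 70, 69, 57,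
      58, 37, 59, 23, 37, 57, 70, 85, 84, 99, 162, 97, 194, 129, 208, 32, 129, 97, 130, 67, 84, 51,
      69, 36, 51, 67, 49, 22, 36, 23, 22, 34, 32, 6, 59, 12, 6]]) (by decide +kernel)

theorem existsQuadFree_four_57 : ExistsQuadFree 4 57 :=
  IsQuadFreeChart.existsQuadFree (T :=
    [[3, 81, 82, 67, 130, 161, 196, 197, 181, 201, 220, 210, 201, 164, 202, 186, 171, 202, 184, 185,
      168, 186, 153, 151, 137, 122, 171, 91, 220, 12, 91, 122, 59, 137, 153, 168, 166, 150, 135,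
      151, 74, 135, 166, 185, 165, 184, 164, 181, 163, 148, 165, 104, 150, 89, 104, 148, 116, 163,
      197, 162, 115, 85, 116, 102, 103, 89, 72, 74, 57, 72, 103, 53, 102, 85, 162, 196, 178, 210,
      192, 178, 161, 84, 115, 69, 84, 130, 129, 192, 32, 129, 67, 51, 69, 36, 54, 53, 36, 51, 82,
      19, 54, 37, 57, 39, 59, 26, 39, 37, 19, 81, 32, 3, 26, 12, 3]]) (by decide +kernel)

theorem existsQuadFree_four_58 : ExistsQuadFree 4 58 :=
  IsQuadFreeChart.existsQuadFree (T :=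
    [[1, 34, 49, 84, 99, 118, 133, 149, 164, 195, 181, 166, 165, 152, 166, 154, 171, 202, 203, 221,
      208, 196, 221, 189, 203, 188, 202, 186, 196, 168, 186, 171, 155, 137, 152, 105, 137, 106, 188,
      123, 106, 155, 154, 181, 168, 195, 131, 164, 135, 165, 136, 135, 149, 120, 104, 58, 136, 27,
      105, 74, 123, 60, 189, 12, 60, 74, 27, 58, 41, 104, 87, 120, 133, 115, 148, 131, 81, 208, 16,
      81, 148, 65, 115, 118, 100, 87, 71, 100, 99, 85, 70, 71, 54, 53, 41, 54, 70, 50, 85, 84, 65,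
      49, 24, 50, 38, 53, 39, 27, 26, 39, 38, 24, 34, 16, 1, 26, 12, 1]]) (by decide +kernel)

theorem existsQuadFree_four_59 : ExistsQuadFree 4 59 :=
  IsQuadFreeChart.existsQuadFree (T :=
    [[1, 64, 224, 232, 217, 205, 232, 212, 213, 197, 194, 180, 197, 184, 199, 217, 171, 199, 170,
      182, 180, 167, 165, 179, 194, 117, 179, 102, 165, 136, 167, 182, 154, 155, 171, 76, 155, 137,
      136, 118, 138, 91, 60, 205, 13, 60, 28, 91, 76, 138, 121, 118, 137, 154, 170, 184, 213, 193,
      162, 146, 193, 132, 116, 86, 121, 88, 70, 116, 85, 162, 99, 98, 67, 99, 85, 70, 57, 88, 75,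
      58, 40, 57, 56, 67, 38, 56, 40, 27, 39, 23, 27, 58, 28, 75, 121, 102, 86, 132, 117, 193, 212,
      224, 113, 146, 65, 98, 51, 65, 113, 64, 34, 51, 21, 39, 38, 21, 34, 1, 23, 13, 1]])
      (by decide +kernel)

theorem existsQuadFree_four_61 : ExistsQuadFree 4 61 :=
  IsQuadFreeChart.existsQuadFree (T :=
    [[4, 35, 52, 82, 99, 100, 131, 164, 151, 179, 162, 177, 226, 238, 214, 220, 170, 203, 186, 168,
      203, 153, 152, 139, 153, 170, 155, 141, 238, 14, 141, 61, 155, 220, 183, 214, 226, 194, 182,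
      183, 168, 182, 167, 194, 177, 16, 162, 49, 179, 167, 151, 186, 134, 152, 123, 134, 151, 132,
      133, 123, 122, 133, 121, 132, 164, 147, 131, 87, 121, 106, 90, 75, 122, 76, 92, 139, 61, 92,
      29, 76, 75, 44, 90, 88, 106, 87, 100, 73, 88, 59, 85, 70, 56, 44, 70, 59, 73, 99, 53, 85, 54,
      53, 82, 33, 147, 49, 33, 52, 21, 54, 39, 56, 43, 29, 23, 43, 39, 21, 35, 16, 4, 23, 14, 4]])
      (by decide +kernel)

theorem existsQuadFree_four_62 : ExistsQuadFree 4 62 :=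
  IsQuadFreeChart.existsQuadFree (T :=
    [[2, 96, 210, 222, 201, 175, 222, 197, 200, 180, 179, 170, 180, 172, 201, 173, 158, 156, 170,
      140, 156, 173, 172, 200, 178, 164, 179, 151, 169, 154, 140, 169, 136, 151, 164, 135, 178, 197,
      210, 145, 163, 135, 119, 163, 129, 148, 132, 119, 136, 107, 108, 154, 93, 158, 142, 175, 15,
      142, 93, 108, 90, 107, 119, 118, 132, 99, 116, 101, 88, 118, 74, 91, 77, 93, 30, 77, 60, 91,
      90, 74, 88, 72, 60, 45, 72, 101, 70, 71, 53, 45, 71, 52, 70, 116, 85, 99, 148, 131, 98, 85,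
      69, 52, 51, 69, 98, 81, 131, 129, 145, 96, 34, 81, 35, 51, 22, 53, 40, 30, 28, 40, 22, 35, 34,
      2, 28, 15, 2]]) (by decide +kernel)

theorem existsQuadFree_four_63 : ExistsQuadFree 4 63 :=
  IsQuadFreeChart.existsQuadFree (T :=
    [[0, 192, 231, 236, 219, 231, 214, 218, 201, 219, 170, 201, 182, 168, 184, 170, 155, 187, 236,
      45, 187, 92, 155, 184, 169, 168, 153, 182, 218, 195, 196, 179, 146, 132, 179, 165, 153, 152,
      164, 149, 136, 105, 89, 70, 105, 90, 136, 103, 149, 101, 132, 116, 115, 85, 103, 87, 70, 52,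
      87, 85, 116, 101, 164, 137, 106, 169, 123, 92, 44, 123, 106, 59, 90, 73, 58, 44, 23, 45, 10,
      23, 58, 40, 53, 89, 34, 53, 38, 40, 73, 59, 137, 152, 165, 196, 178, 195, 214, 192, 145, 178,
      97, 99, 146, 68, 115, 69, 68, 99, 50, 67, 51, 69, 52, 51, 34, 67, 17, 38, 18, 17, 50, 97, 145,
      0, 18, 10, 0]]) (by decide +kernel)

theorem existsQuadFree_four_64 : ExistsQuadFree 4 64 :=
  IsQuadFreeChart.existsQuadFree (T :=
    [[1, 48, 224, 232, 218, 216, 205, 218, 206, 232, 194, 214, 197, 216, 198, 182, 201, 183, 168,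
      185, 123, 201, 140, 205, 124, 140, 123, 122, 91, 124, 93, 45, 206, 14, 45, 28, 93, 91, 43,
      122, 185, 106, 168, 167, 183, 182, 165, 198, 197, 162, 149, 180, 165, 134, 167, 136, 152, 106,
      58, 152, 89, 136, 134, 180, 103, 116, 102, 58, 43, 102, 87, 116, 89, 103, 149, 133, 146, 115,
      100, 71, 54, 40, 28, 54, 43, 71, 53, 100, 87, 115, 133, 162, 214, 177, 194, 224, 145, 114,
      177, 99, 146, 68, 99, 114, 98, 67, 68, 50, 53, 39, 50, 67, 49, 98, 145, 48, 18, 49, 36, 39,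
      22, 40, 23, 22, 36, 18, 1, 23, 14, 1]]) (by decide +kernel)

theorem existsQuadFree_four_65 : ExistsQuadFree 4 65 :=
  IsQuadFreeChart.existsQuadFree (T :=
    [[0, 160, 225, 238, 219, 225, 194, 195, 214, 219, 205, 155, 140, 141, 238, 46, 141, 109, 140,
      205, 170, 188, 171, 138, 155, 106, 138, 188, 153, 170, 219, 186, 199, 183, 182, 199, 168, 167,
      149, 183, 148, 149, 136, 171, 121, 136, 167, 153, 168, 186, 214, 164, 182, 147, 164, 195, 145,
      162, 116, 147, 117, 148, 134, 121, 101, 106, 124, 109, 60, 124, 72, 107, 91, 60, 42, 91, 57,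
      107, 56, 72, 106, 86, 101, 134, 117, 116, 100, 86, 70, 100, 162, 83, 129, 82, 68, 70, 56, 68,
      53, 66, 39, 58, 41, 42, 22, 46, 12, 22, 41, 21, 58, 57, 39, 53, 82, 83, 145, 194, 160, 49,
      129, 18, 66, 37, 21, 20, 37, 18, 49, 0, 20, 12, 0]]) (by decide +kernel)

theorem existsQuadFree_four_67 : ExistsQuadFree 4 67 :=
  IsQuadFreeChart.existsQuadFree (T :=
    [[0, 224, 252, 254, 205, 252, 210, 232, 234, 219, 188, 156, 219, 205, 234, 203, 216, 198, 199,
      184, 125, 188, 173, 254, 78, 173, 125, 108, 184, 155, 199, 179, 198, 178, 216, 185, 156, 155,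
      185, 203, 232, 193, 178, 177, 146, 179, 164, 181, 166, 149, 135, 102, 149, 137, 136, 87, 70,
      135, 86, 70, 136, 88, 137, 166, 153, 199, 138, 122, 108, 77, 122, 89, 88, 75, 76, 58, 87, 71,
      58, 75, 89, 138, 153, 181, 116, 117, 102, 101, 83, 68, 86, 51, 71, 53, 51, 68, 101, 117, 99,
      116, 164, 146, 130, 177, 193, 210, 224, 49, 130, 115, 99, 33, 83, 50, 24, 53, 42, 76, 43, 77,
      27, 78, 13, 27, 43, 42, 24, 19, 50, 33, 115, 49, 0, 19, 13, 0]]) (by decide +kernel)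

theorem existsQuadFree_four_68 : ExistsQuadFree 4 68 :=
  IsQuadFreeChart.existsQuadFree (T :=
    [[1, 208, 245, 253, 232, 230, 216, 234, 220, 253, 175, 220, 173, 234, 185, 216, 232, 245, 227,
      212, 230, 196, 215, 185, 168, 186, 173, 158, 186, 171, 168, 215, 182, 196, 212, 210, 194, 182,
      153, 180, 163, 147, 180, 166, 150, 164, 133, 117, 147, 86, 117, 164, 135, 134, 122, 135, 150,
      123, 166, 153, 171, 154, 139, 123, 108, 139, 125, 158, 78, 61, 108, 60, 122, 106, 121, 104,
      134, 103, 133, 87, 103, 104, 71, 121, 75, 89, 72, 39, 89, 57, 75, 106, 60, 61, 45, 57, 26, 40,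
      19, 26, 45, 78, 175, 15, 78, 125, 154, 153, 194, 81, 163, 98, 81, 210, 227, 208, 17, 98, 67,
      100, 86, 51, 87, 37, 72, 71, 37, 51, 100, 18, 40, 39, 18, 67, 17, 1, 19, 15, 1]])
      (by decide +kernel)

theorem existsQuadFree_four_70 : ExistsQuadFree 4 70 :=
  IsQuadFreeChart.existsQuadFree (T :=
    [[1, 144, 240, 254, 230, 237, 215, 228, 214, 198, 220, 201, 187, 237, 156, 186, 168, 201, 151,
      168, 153, 155, 137, 136, 123, 137, 124, 155, 134, 153, 186, 140, 189, 254, 110, 189, 109, 124,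
      107, 109, 140, 156, 187, 220, 200, 184, 167, 149, 134, 167, 151, 184, 165, 200, 198, 181, 214,
      215, 230, 240, 211, 178, 228, 179, 196, 181, 163, 165, 132, 163, 196, 146, 179, 178, 161, 145,
      130, 117, 146, 103, 136, 118, 149, 132, 118, 103, 117, 102, 115, 99, 114, 145, 35, 114, 36,
      99, 52, 115, 84, 123, 87, 107, 93, 110, 12, 93, 60, 73, 91, 72, 73, 42, 56, 55, 72, 36, 55,
      18, 56, 21, 42, 60, 107, 70, 91, 52, 70, 87, 84, 102, 130, 161, 211, 144, 66, 35, 18, 66, 1,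
      21, 12, 1]]) (by decide +kernel)

theorem existsQuadFree_four_71 : ExistsQuadFree 4 71 :=
  IsQuadFreeChart.existsQuadFree (T :=
    [[6, 34, 100, 84, 101, 115, 102, 117, 131, 104, 135, 164, 121, 107, 153, 179, 229, 249, 251,
      236, 222, 268, 240, 226, 268, 207, 222, 251, 218, 233, 215, 214, 233, 202, 216, 201, 215, 198,
      201, 172, 216, 187, 236, 205, 188, 172, 125, 188, 157, 205, 187, 202, 218, 249, 196, 214, 181,
      196, 229, 226, 179, 225, 161, 240, 32, 161, 114, 225, 146, 179, 155, 181, 169, 198, 171, 169,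
      155, 153, 92, 171, 125, 92, 107, 164, 146, 135, 89, 105, 59, 121, 60, 106, 92, 30, 157, 46,
      207, 15, 46, 30, 106, 45, 60, 59, 43, 105, 58, 89, 104, 117, 73, 86, 58, 73, 102, 101, 54, 86,
      71, 55, 43, 71, 54, 84, 35, 55, 22, 45, 27, 22, 35, 100, 83, 115, 98, 131, 114, 98, 83, 34,
      32, 6, 27, 15, 6]]) (by decide +kernel)

theorem existsQuadFree_four_73 : ExistsQuadFree 4 73 :=
  IsQuadFreeChart.existsQuadFree (T :=
    [[0, 240, 251, 236, 205, 190, 140, 205, 187, 236, 207, 126, 190, 157, 126, 63, 207, 251, 229,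
      227, 219, 202, 186, 140, 139, 125, 157, 62, 44, 63, 11, 44, 24, 62, 125, 108, 139, 186, 169,
      202, 187, 219, 201, 199, 218, 227, 193, 218, 178, 166, 165, 146, 130, 193, 51, 130, 99, 146,
      132, 165, 178, 199, 182, 135, 150, 166, 117, 150, 104, 103, 119, 117, 101, 132, 115, 101, 119,
      86, 100, 115, 84, 99, 83, 84, 100, 71, 86, 103, 89, 73, 58, 89, 104, 135, 121, 182, 201, 184,
      183, 106, 121, 59, 58, 38, 56, 19, 38, 59, 106, 60, 183, 107, 169, 92, 108, 61, 40, 60, 39,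
      22, 19, 39, 40, 24, 61, 92, 107, 184, 219, 229, 240, 98, 51, 17, 56, 36, 83, 54, 73, 71, 54,
      36, 17, 98, 0, 22, 11, 0]]) (by decide +kernel)

theorem existsQuadFree_three {N : ℕ} (hN : 10 ≤ N) : ExistsQuadFree 3 N := by
  induction N using Nat.strong_induction_on with
  | _ N ih =>
    obtain hlt | hge := lt_or_ge N 20
    · interval_cases N
      exacts [existsQuadFree_three_10, existsQuadFree_three_11, existsQuadFree_three_12,
        existsQuadFree_three_13, existsQuadFree_three_14, existsQuadFree_three_15,
        existsQuadFree_three_16, existsQuadFree_three_17, existsQuadFree_three_18,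
        existsQuadFree_three_19]
    · have hadd := (ih (N - 10) (by omega) (by omega)).add existsQuadFree_three_10
      rwa [Nat.sub_add_cancel hN] at hadd

theorem existsQuadFree_four {N : ℕ} (hN : 44 ≤ N) : ExistsQuadFree 4 N := by
  induction N using Nat.strong_induction_on with
  | _ N ih =>
    obtain hlt | hge := lt_or_ge N 74
    · interval_cases N
      exacts [existsQuadFree_four_44, existsQuadFree_four_45, existsQuadFree_four_46,
        existsQuadFree_four_47, existsQuadFree_four_48, existsQuadFree_four_49,
        existsQuadFree_four_50, existsQuadFree_four_51, existsQuadFree_four_52,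
        existsQuadFree_four_53, existsQuadFree_four_54, existsQuadFree_four_55,
        existsQuadFree_four_56, existsQuadFree_four_57, existsQuadFree_four_58,
        existsQuadFree_four_59, existsQuadFree_four_30.add existsQuadFree_four_30,
        existsQuadFree_four_61, existsQuadFree_four_62, existsQuadFree_four_63,
        existsQuadFree_four_64, existsQuadFree_four_65,
        existsQuadFree_four_30.add existsQuadFree_four_36, existsQuadFree_four_67,
        existsQuadFree_four_68, existsQuadFree_four_30.add existsQuadFree_four_39,
        existsQuadFree_four_70, existsQuadFree_four_71,
        existsQuadFree_four_36.add existsQuadFree_four_36, existsQuadFree_four_73]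
    · have hadd := (ih (N - 30) (by omega) (by omega)).add existsQuadFree_four_30
      rwa [Nat.sub_add_cancel (by omega)] at hadd

end Examples

theorem mainTheorem5_general {W : Type*} [Fintype W] (H : SimpleGraph W) :
    (7 ≤ Fintype.card W →
      Fintype.card W + 4 ≤ planarRamsey (cycleGraph 4) (coneGraph H)) ∧
    (Fintype.card W ∈ ({26, 32, 35, 38} : Set ℕ) ∨ 40 ≤ Fintype.card W →
      Fintype.card W + 5 ≤ planarRamsey (cycleGraph 4) (coneGraph H)) := by
  constructor
  · intro h
    have hthree : ExistsQuadFree 3 (Fintype.card W + 3) := existsQuadFree_three (by omega)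
    exact hthree.card_add_lt_planarRamsey H three_pos
  · intro h
    have hfour : ExistsQuadFree 4 (Fintype.card W + 4) := by
      obtain (h | h | h | h) | h := h
      · exact h ▸ existsQuadFree_four_30
      · exact h ▸ existsQuadFree_four_36
      · exact h ▸ existsQuadFree_four_39
      · exact h ▸ existsQuadFree_four_42
      · exact existsQuadFree_four (by omega)
    exact hfour.card_add_lt_planarRamsey H four_pos

theorem mainTheorem5 (n : ℕ) :
    ((7 ≤ n ∧ n ≤ 25) ∨ n ∈ ({27, 28, 29, 30, 31, 33, 34, 36, 37, 39} : Set ℕ) →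
      n + 4 ≤ planarRamsey (SimpleGraph.cycleGraph 4) (wheelGraph n)) ∧
    (n ∈ ({26, 32, 35, 38} : Set ℕ) ∨ 40 ≤ n →
      n + 5 ≤ planarRamsey (SimpleGraph.cycleGraph 4) (wheelGraph n)) := by
  have h := mainTheorem5_general (cycleGraph n)
  rw [Fintype.card_fin] at h
  exact h.imp_left fun hthree hn => hthree (by simp at hn; omega)
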